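/- Let $a_0,a_1,a_2,\dots$ be i.i.d. standard complex Gaussian random variables (each with density $\frac1\pi e^{-|z|^2}$ with respect to Lebesgue measure on $\mathbb{C}$), and let $$\mathbf g(z)=\sum_{n=0}^{\infty}\frac{a_n z^n}{\sqrt{n!}},\qquad z\in\mathbb{C},$$ be the planar Gaussian analytic function (the series almost surely converges on all of $\mathbb{C}$). Fix $r>0$, and let $n(r)$ be the number of zeros of $\mathbf g$, counted with multiplicity, in the open disk $\{|z|<r\}$. Then: 1. There is a constant $C$, depending only on $r$, such that for every integer $m\ge 1$, $$\mathbf P[n(r)\ge m]\;\ge\; e^{-\frac12 m^2\log m-Cm^2}.$$ 2. For every $\varepsilon>0$ there is a constant $C_2$, depending only on $\varepsilon$ and $r$, such that for every integer $m\ge 1$, $$\mathbf P[n(r)\ge m]\;\le\; C_2\,e^{-(\frac12-\varepsilon)m^2\log m}.$$ 3. In particular, there is a sequence $\delta_m\to 0$ (as $m\to\infty$), depending only on $r$, such that for every integer $m\ge 2$, $$\mathbf P[n(r)\ge m]= e^{-\frac12 m^2\log m\,(1+\delta_m)}.$$ -/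

import Mathlib

open MeasureTheory ProbabilityTheory Filter Topology
open scoped Nat

universe u

/-- The law of a standard complex Gaussian: the probability measure on `ℂ` with density
`π⁻¹ exp (-|z|²)` with respect to Lebesgue measure. -/
noncomputable def stdComplexGaussian : Measure ℂ :=
  (volume : Measure ℂ).withDensity fun z => ENNReal.ofReal (Real.pi⁻¹ * Real.exp (-‖z‖ ^ 2))

/-- The random variables `a 0, a 1, a 2, …` are i.i.d. standard complex Gaussians under `P`. -/
structure IsIIDStdComplexGaussian {Ω : Type u} [MeasurableSpace Ω] (P : Measure Ω)
    (a : ℕ → Ω → ℂ) : Prop where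
  indep : iIndepFun a P
  law : ∀ n, HasLaw (a n) stdComplexGaussian P

/-- The function `z ↦ ∑ₙ cₙ zⁿ / √(n!)` with coefficient sequence `c`. When the `cₙ` are
i.i.d. standard complex Gaussians the series almost surely converges on all of `ℂ`,
and this is the planar Gaussian analytic function. -/
noncomputable def planarSeries (c : ℕ → ℂ) (z : ℂ) : ℂ :=
  ∑' n : ℕ, c n * z ^ n / ((√(n ! : ℝ) : ℝ) : ℂ)

/-- The number of zeros of `f`, counted with multiplicity, in the open disk of radius `r`
centred at `0`: the sum of the vanishing orders of `f` over all points of the disk,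
as the supremum of the sums over its finite subsets (so it is `⊤` if `f` vanishes identically). -/
noncomputable def zeroCount (f : ℂ → ℂ) (r : ℝ) : ℕ∞ :=
  ⨆ (s : Finset ℂ) (_ : (s : Set ℂ) ⊆ Metric.ball 0 r), ∑ z ∈ s, analyticOrderAt f z

/-- The probability `P[n(r) ≥ m]`, where `n(r)` is the number of zeros in the disk of radius `r`
of the random series with coefficients `a 0, a 1, a 2, …`. -/
noncomputable def overcrowdingProb {Ω : Type u} [MeasurableSpace Ω] (P : Measure Ω)
    (a : ℕ → Ω → ℂ) (r : ℝ) (m : ℕ) : ℝ :=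
  P.real {ω | (m : ℕ∞) ≤ zeroCount (planarSeries fun n => a n ω) r}

/-! Having `m` zeros is paid for by small coefficients `c n`, `n < m`, and a complex Gaussian lies
in a disk of small radius `ρ` about `0` with probability of order `ρ²`. Constants below depend on
`r` only.

Upper bound. Dividing out `m` zeros, an entire function bounded by `M` on `|z| = R` is at most `M
(2r/(R-r))^m` on `|z| ≤ r` (`norm_le_of_le_zeroCount`). Take `R = 2r√m`. Outside an event of
probability at most `4 exp(-m⁴/2)` all `|c n| ≤ m² 2^n`, so `M = e^{O(m)}` and the function is at
most `e^{O(m)} m^{-m/2}` on the small disk. Cauchy's estimate gives `|c n|² ≤ n! m^{-m} e^{O(m)}`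
for `n < m`; by independence the probability is at most the product of these bounds, `exp(-½ m² log
m + O(m²))`.

Lower bound. If `|c n|² ≤ (n!/m!) s^{2m}` for `n < m`, `c m` is at least a multiple of `m`, and the
later coefficients grow at most geometrically, then the `m`-th term dominates on `r/2 ≤ |z| ≤ r`,
and Rouché gives exactly `m` zeros (`zeroCount_planarSeries_eq`). The small coefficients cost `∏
n!/m!`, again `exp(-½ m² log m)` up to `e^{O(m²)}`.

Jensen's formula reads the zero count off circle averages of `log ‖f‖`. This yields both Rouché's
theorem and the measurability needed to move the event from `Ω` to sequence space. -/

/-! ### Disk and tail estimates for one complex Gaussian -/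

theorem integrable_exp_neg_mul_sq_norm {b : ℝ} (hb : 0 < b) :
    Integrable fun z : ℂ => Real.exp (-b * ‖z‖ ^ 2) := by
  by_contra h
  -- The integral of a non-integrable function is `0` by convention, but this one is positive.
  have h1 := GaussianFourier.integral_rexp_neg_mul_sq_norm (V := ℂ) hb
  rw [integral_undef h] at h1
  have : 0 < (Real.pi / b) ^ (Module.finrank ℝ ℂ / 2 : ℝ) := by positivity
  linarith

theorem lintegral_exp_neg_mul_sq_norm {b : ℝ} (hb : 0 < b) :
    ∫⁻ z : ℂ, ENNReal.ofReal (Real.pi⁻¹ * Real.exp (-b * ‖z‖ ^ 2)) = ENNReal.ofReal b⁻¹ := by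
  rw [← ofReal_integral_eq_lintegral_ofReal
    ((integrable_exp_neg_mul_sq_norm hb).const_mul _) (ae_of_all _ fun z => by positivity),
    integral_const_mul, GaussianFourier.integral_rexp_neg_mul_sq_norm hb]
  congr 1
  simp only [Complex.finrank_real_complex]
  norm_num
  field_simp

theorem stdComplexGaussian_apply {s : Set ℂ} (hs : MeasurableSet s) :
    stdComplexGaussian s = ∫⁻ z in s, ENNReal.ofReal (Real.pi⁻¹ * Real.exp (-‖z‖ ^ 2)) :=
  withDensity_apply _ hs

instance : IsProbabilityMeasure stdComplexGaussian where
  measure_univ := by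
    rw [stdComplexGaussian_apply MeasurableSet.univ, Measure.restrict_univ]
    simpa using lintegral_exp_neg_mul_sq_norm one_pos

theorem stdComplexGaussian_compl_ball_le (t : ℝ) (ht : 0 ≤ t) :
    stdComplexGaussian {z | t ≤ ‖z‖} ≤ ENNReal.ofReal (2 * Real.exp (-t ^ 2 / 2)) := by
  have hs : MeasurableSet {z : ℂ | t ≤ ‖z‖} := measurableSet_le measurable_const measurable_norm
  rw [stdComplexGaussian_apply hs]
  calc ∫⁻ z in {z : ℂ | t ≤ ‖z‖}, ENNReal.ofReal (Real.pi⁻¹ * Real.exp (-‖z‖ ^ 2))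
      -- Half of the exponent pays for `exp (-t²/2)`; the other half is integrated over the plane
      -- and gives the factor `2`.
      ≤ ∫⁻ z in {z : ℂ | t ≤ ‖z‖}, ENNReal.ofReal (Real.exp (-t ^ 2 / 2)) *
          ENNReal.ofReal (Real.pi⁻¹ * Real.exp (-(1 / 2) * ‖z‖ ^ 2)) := by
        refine setLIntegral_mono' hs fun z hz => ?_
        rw [← ENNReal.ofReal_mul (by positivity)]
        refine ENNReal.ofReal_le_ofReal ?_
        rw [mul_left_comm, ← Real.exp_add]
        gcongr
        have : t ^ 2 ≤ ‖z‖ ^ 2 := pow_le_pow_left₀ ht hz 2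
        linarith
    _ ≤ ∫⁻ z : ℂ, ENNReal.ofReal (Real.exp (-t ^ 2 / 2)) *
          ENNReal.ofReal (Real.pi⁻¹ * Real.exp (-(1 / 2) * ‖z‖ ^ 2)) := setLIntegral_le_lintegral _ _
    _ = ENNReal.ofReal (2 * Real.exp (-t ^ 2 / 2)) := by
        rw [lintegral_const_mul _ (by fun_prop), lintegral_exp_neg_mul_sq_norm (by norm_num),
          ← ENNReal.ofReal_mul (by positivity)]
        congr 1
        norm_num
        ring

theorem stdComplexGaussian_closedBall_le (ρ : ℝ) (hρ : 0 ≤ ρ) :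
    stdComplexGaussian (Metric.closedBall 0 ρ) ≤ ENNReal.ofReal (ρ ^ 2) := by
  rw [stdComplexGaussian_apply measurableSet_closedBall]
  calc ∫⁻ z in Metric.closedBall (0 : ℂ) ρ, ENNReal.ofReal (Real.pi⁻¹ * Real.exp (-‖z‖ ^ 2))
      ≤ ∫⁻ z in Metric.closedBall (0 : ℂ) ρ, ENNReal.ofReal Real.pi⁻¹ := by
        refine setLIntegral_mono' measurableSet_closedBall fun z hz => ?_
        refine ENNReal.ofReal_le_ofReal (mul_le_of_le_one_right (by positivity) ?_)
        rw [Real.exp_le_one_iff]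
        nlinarith [sq_nonneg ‖z‖]
    _ = ENNReal.ofReal (ρ ^ 2) := by
        rw [setLIntegral_const, Complex.volume_closedBall, ← ENNReal.ofReal_pow hρ,
          ← ENNReal.ofReal_coe_nnreal, ← ENNReal.ofReal_mul (by positivity),
          ← ENNReal.ofReal_mul (by positivity), NNReal.coe_real_pi]
        congr 1
        field_simp

theorem le_stdComplexGaussian_closedBall (w : ℂ) (ρ : ℝ) (hρ : 0 ≤ ρ) :
    ENNReal.ofReal (ρ ^ 2 * Real.exp (-(‖w‖ + ρ) ^ 2)) ≤
      stdComplexGaussian (Metric.closedBall w ρ) := by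
  rw [stdComplexGaussian_apply measurableSet_closedBall]
  calc ENNReal.ofReal (ρ ^ 2 * Real.exp (-(‖w‖ + ρ) ^ 2))
      = ∫⁻ z in Metric.closedBall w ρ,
          ENNReal.ofReal (Real.pi⁻¹ * Real.exp (-(‖w‖ + ρ) ^ 2)) := by
        rw [setLIntegral_const, Complex.volume_closedBall, ← ENNReal.ofReal_pow hρ,
          ← ENNReal.ofReal_coe_nnreal, ← ENNReal.ofReal_mul (by positivity),
          ← ENNReal.ofReal_mul (by positivity), NNReal.coe_real_pi]
        congr 1
        field_simp
    _ ≤ ∫⁻ z in Metric.closedBall w ρ,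
          ENNReal.ofReal (Real.pi⁻¹ * Real.exp (-‖z‖ ^ 2)) := by
        refine setLIntegral_mono' measurableSet_closedBall fun z hz => ?_
        refine ENNReal.ofReal_le_ofReal ?_
        have h1 : ‖z‖ ≤ ‖w‖ + ρ := by
          have := norm_le_norm_add_norm_sub' z w
          rw [mem_closedBall_iff_norm] at hz
          linarith
        gcongr

theorem le_stdComplexGaussian_closedBall_zero (ρ : ℝ) (hρ : 0 ≤ ρ) (h1 : ρ ≤ 1) :
    ENNReal.ofReal (ρ ^ 2 * Real.exp (-1)) ≤ stdComplexGaussian (Metric.closedBall 0 ρ) := by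
  refine le_trans (ENNReal.ofReal_le_ofReal ?_) (le_stdComplexGaussian_closedBall 0 ρ hρ)
  rw [norm_zero, zero_add]
  gcongr
  nlinarith

theorem le_stdComplexGaussian_compl_ball (t : ℝ) (ht : 0 ≤ t) :
    ENNReal.ofReal (Real.exp (-(t + 2) ^ 2)) ≤ stdComplexGaussian {z | t ≤ ‖z‖} := by
  -- The unit disk about `t + 1` lies between the circles of radius `t` and `t + 2`.
  have h := le_stdComplexGaussian_closedBall ((t + 1 : ℝ) : ℂ) 1 zero_le_one
  rw [Complex.norm_real, Real.norm_of_nonneg (by positivity), one_pow, one_mul, add_assoc] at h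
  norm_num at h
  refine h.trans (measure_mono fun z hz => ?_)
  rw [mem_closedBall_iff_norm'] at hz
  have := norm_sub_norm_le ((t + 1 : ℝ) : ℂ) z
  rw [Complex.norm_real, Real.norm_of_nonneg (by positivity)] at this
  push_cast at this hz
  change t ≤ ‖z‖
  linarith

/-! ### Law of the coefficient sequence -/

/-- The joint law of a sequence of i.i.d. standard complex Gaussian random variables. -/
noncomputable def gaussianSeqLaw : Measure (ℕ → ℂ) :=
  Measure.infinitePi fun _ => stdComplexGaussian

instance : IsProbabilityMeasure gaussianSeqLaw := by
  unfold gaussianSeqLaw; infer_instance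

theorem gaussianSeqLaw_eval_preimage (n : ℕ) {s : Set ℂ} (hs : MeasurableSet s) :
    gaussianSeqLaw {c | c n ∈ s} = stdComplexGaussian s := by
  have h : gaussianSeqLaw.map (fun c => c n) = stdComplexGaussian :=
    Measure.infinitePi_map_eval (fun _ => stdComplexGaussian) n
  rw [← h, Measure.map_apply (measurable_pi_apply n) hs]
  rfl

theorem hasLaw_gaussianSeqLaw {Ω : Type u} [MeasurableSpace Ω] {P : Measure Ω}
    {a : ℕ → Ω → ℂ} (h : IsIIDStdComplexGaussian P a) :
    HasLaw (fun ω n => a n ω) gaussianSeqLaw P :=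
  h.indep.hasLaw_infinitePi h.law (aemeasurable_pi_iff.2 fun n => (h.law n).aemeasurable)

/-! ### Entire series with geometrically growing coefficients -/

/-- The square of the left side is a single term of the series of `exp (y²)`, up to sign conventions
only. -/
theorem pow_div_sqrt_factorial_le (y : ℝ) (n : ℕ) :
    y ^ n / √(n ! : ℝ) ≤ Real.exp (y ^ 2 / 2) := by
  have h := Real.pow_div_factorial_le_exp (y ^ 2) (sq_nonneg y) n
  have h2 : (y ^ n / √(n ! : ℝ)) ^ 2 ≤ Real.exp (y ^ 2 / 2) ^ 2 := by
    rw [div_pow, Real.sq_sqrt (by positivity), ← Real.exp_nat_mul]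
    calc (y ^ n) ^ 2 / (n ! : ℝ) = (y ^ 2) ^ n / (n ! : ℝ) := by rw [← pow_mul, ← pow_mul, mul_comm]
      _ ≤ _ := h
      _ = _ := by congr 1; push_cast; ring
  exact le_of_sq_le_sq h2 (Real.exp_pos _).le

theorem norm_planarSeries_term_le {c : ℕ → ℂ} {K x : ℝ} (hc : ∀ n, ‖c n‖ ≤ K * 2 ^ n) {z : ℂ}
    (hz : ‖z‖ ≤ x) (n : ℕ) :
    ‖c n * z ^ n / ((√(n ! : ℝ) : ℝ) : ℂ)‖ ≤ K * Real.exp (8 * x ^ 2) * (1 / 2) ^ n := by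
  have hx : 0 ≤ x := (norm_nonneg z).trans hz
  have hK : 0 ≤ K := by simpa using (norm_nonneg (c 0)).trans (hc 0)
  rw [norm_div, norm_mul, norm_pow, Complex.norm_real, Real.norm_of_nonneg (Real.sqrt_nonneg _)]
  calc ‖c n‖ * ‖z‖ ^ n / √(n ! : ℝ) ≤ (K * 2 ^ n) * x ^ n / √(n ! : ℝ) := by
        gcongr
        exact hc n
    -- Writing `2^n x^n = (4x)^n 2^{-n}` keeps a summable factor; `(4x)²/2` is the source of `8x²`.
    _ = K * ((4 * x) ^ n / √(n ! : ℝ)) * (1 / 2) ^ n := by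
        have : (4 : ℝ) ^ n = 2 ^ n * 2 ^ n := by rw [← mul_pow]; norm_num
        rw [mul_pow, this, one_div, inv_pow]
        field_simp
    _ ≤ K * Real.exp ((4 * x) ^ 2 / 2) * (1 / 2) ^ n := by
        gcongr
        exact pow_div_sqrt_factorial_le _ n
    _ = _ := by congr 3; ring

theorem summable_planarSeries_term {c : ℕ → ℂ} {K : ℝ} (hc : ∀ n, ‖c n‖ ≤ K * 2 ^ n) (z : ℂ) :
    Summable fun n : ℕ => c n * z ^ n / ((√(n ! : ℝ) : ℝ) : ℂ) :=
  Summable.of_norm_bounded (summable_geometric_two.mul_left _)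
    fun n => norm_planarSeries_term_le hc le_rfl n

theorem norm_planarSeries_le {c : ℕ → ℂ} {K x : ℝ} (hc : ∀ n, ‖c n‖ ≤ K * 2 ^ n) {z : ℂ}
    (hz : ‖z‖ ≤ x) : ‖planarSeries c z‖ ≤ K * Real.exp (8 * x ^ 2) * 2 :=
  tsum_of_norm_bounded (hasSum_geometric_two.mul_left _)
    fun n => norm_planarSeries_term_le hc hz n

theorem hasFPowerSeriesOnBall_planarSeries {c : ℕ → ℂ} {K : ℝ} (hc : ∀ n, ‖c n‖ ≤ K * 2 ^ n) :
    HasFPowerSeriesOnBall (planarSeries c)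
      (FormalMultilinearSeries.ofScalars ℂ fun n => c n / ((√(n ! : ℝ) : ℝ) : ℂ)) 0 ⊤ := by
  set p := FormalMultilinearSeries.ofScalars ℂ fun n => c n / ((√(n ! : ℝ) : ℝ) : ℂ)
  have hp : p.radius = ⊤ := by
    refine FormalMultilinearSeries.radius_eq_top_of_summable_norm _ fun r => ?_
    refine Summable.of_nonneg_of_le (fun n => by positivity) (fun n => ?_)
      (summable_geometric_two.mul_left (K * Real.exp (8 * (r : ℝ) ^ 2)))
    have h := norm_planarSeries_term_le hc (z := ((r : ℝ) : ℂ)) (x := r) (by simp) n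
    refine le_trans (le_of_eq ?_) h
    simp only [p, FormalMultilinearSeries.ofScalars_norm, norm_div, norm_mul, norm_pow,
      Complex.norm_real, NNReal.norm_eq]
    ring
  have h := p.hasFPowerSeriesOnBall (by rw [hp]; exact ENNReal.zero_lt_top)
  rw [hp] at h
  convert h using 1
  ext z
  simp only [planarSeries, FormalMultilinearSeries.sum, p,
    FormalMultilinearSeries.ofScalars_apply_eq, smul_eq_mul]
  exact tsum_congr fun n => by ring

theorem differentiable_planarSeries {c : ℕ → ℂ} {K : ℝ} (hc : ∀ n, ‖c n‖ ≤ K * 2 ^ n) :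
    Differentiable ℂ (planarSeries c) := fun z =>
  ((hasFPowerSeriesOnBall_planarSeries hc).analyticAt_of_mem (by simp)).differentiableAt

theorem norm_coeff_planarSeries_le {c : ℕ → ℂ} {K r M : ℝ} (hc : ∀ n, ‖c n‖ ≤ K * 2 ^ n)
    (hr : 0 < r) (hM : ∀ z : ℂ, ‖z‖ = r → ‖planarSeries c z‖ ≤ M) (n : ℕ) :
    ‖c n‖ ≤ √(n ! : ℝ) * M / r ^ n := by
  have h1 := Complex.norm_iteratedDeriv_le_of_forall_mem_sphere_norm_le (c := 0) n hr
    (differentiable_planarSeries hc).diffContOnCl (C := M) fun z hz => hM z (by simpa using hz)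
  have h2 := (hasFPowerSeriesOnBall_planarSeries hc).factorial_smul (1 : ℂ) n
  rw [iteratedDeriv_eq_iteratedFDeriv, ← h2, FormalMultilinearSeries.ofScalars_apply_eq,
    one_pow, smul_eq_mul, mul_one, nsmul_eq_mul, norm_mul, norm_div, Complex.norm_natCast,
    Complex.norm_real, Real.norm_of_nonneg (Real.sqrt_nonneg _)] at h1
  have hn : (0 : ℝ) < (n ! : ℝ) := by positivity
  rw [mul_div_assoc, mul_le_mul_iff_right₀ hn, div_le_iff₀ (by positivity)] at h1
  calc ‖c n‖ ≤ _ := h1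
    _ = _ := by ring

theorem planarSeries_eq_zero_iff {c : ℕ → ℂ} {K : ℝ} (hc : ∀ n, ‖c n‖ ≤ K * 2 ^ n) :
    planarSeries c = 0 ↔ c = 0 := by
  constructor
  · intro h
    ext n
    have := norm_coeff_planarSeries_le hc one_pos (M := 0) (fun z _ => by simp [h]) n
    simpa using this
  · rintro rfl
    ext z
    simp [planarSeries]

/-! ### Many zeros force smallness -/

/-- Dividing out `m` zeros inside a small disk: an entire function bounded on a large circle
is small on the small disk. -/
theorem norm_le_of_le_sum_analyticOrderAt {r R : ℝ} (hr : 0 < r) (hR : r < R) (m : ℕ) :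
    ∀ (f : ℂ → ℂ) (M : ℝ) (s : Finset ℂ), Differentiable ℂ f → (s : Set ℂ) ⊆ Metric.ball 0 r →
      (m : ℕ∞) ≤ ∑ z ∈ s, analyticOrderAt f z → (∀ z : ℂ, ‖z‖ = R → ‖f z‖ ≤ M) →
      ∀ z : ℂ, ‖z‖ ≤ r → ‖f z‖ ≤ M * (2 * r / (R - r)) ^ m := by
  induction m with
  | zero =>
    intro f M s hf _ _ hM z hz
    rw [pow_zero, mul_one]
    refine Complex.norm_le_of_forall_mem_frontier_norm_le (U := Metric.ball 0 R)
      Metric.isBounded_ball hf.diffContOnCl (fun w hw => hM w ?_) (subset_closure ?_)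
    · rw [frontier_ball _ (by linarith)] at hw
      simpa using hw
    · rw [mem_ball_zero_iff]; linarith
  | succ m ih =>
    intro f M s hf hs hm hM z hz
    obtain ⟨u, hu, hu0⟩ : ∃ u ∈ s, analyticOrderAt f u ≠ 0 := by
      by_contra! h
      rw [Finset.sum_eq_zero h] at hm
      simp at hm
    have hur : ‖u‖ < r := by simpa using hs hu
    have hfu : f u = 0 := apply_eq_zero_of_analyticOrderAt_ne_zero hu0
    -- `g` is `f` divided by `z - u`, which removes one zero. The divisor is at least `R - r` on the
    -- large circle and at most `2r` on the small disk, so each zero gains `2r/(R-r)`.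
    set g := dslope f u with hg
    have hgd : Differentiable ℂ g := by
      rw [← differentiableOn_univ]
      exact (Complex.differentiableOn_dslope univ_mem).2 hf.differentiableOn
    have hfg : ∀ w, f w = (w - u) * g w := fun w => by
      have := sub_smul_dslope f u w
      rw [hfu, sub_zero, smul_eq_mul] at this
      exact this.symm
    have hfg' : f = (fun w => w - u) * g := funext hfg
    have hord : ∀ w, analyticOrderAt f w = analyticOrderAt (fun w => w - u) w +
        analyticOrderAt g w := fun w => by
      rw [hfg', analyticOrderAt_mul (by fun_prop) (hgd.analyticAt w)]
    have hou : analyticOrderAt (fun w => w - u) u = 1 :=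
      analyticOrderAt_id_sub_const_self
    have hsum : ∑ w ∈ s, analyticOrderAt f w = 1 + ∑ w ∈ s, analyticOrderAt g w := by
      rw [Finset.sum_congr rfl fun w _ => hord w, Finset.sum_add_distrib]
      congr 1
      rw [Finset.sum_eq_single_of_mem u hu, hou]
      intro w _ hwu
      rw [AnalyticAt.analyticOrderAt_eq_zero (by fun_prop)]
      exact sub_ne_zero.2 hwu
    have hm' : (m : ℕ∞) ≤ ∑ w ∈ s, analyticOrderAt g w := by
      rw [hsum, add_comm, Nat.cast_add, Nat.cast_one] at hm
      exact (ENat.add_le_add_iff_left ENat.one_ne_top).1 hm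
    have hgM : ∀ w : ℂ, ‖w‖ = R → ‖g w‖ ≤ M / (R - r) := fun w hw => by
      have h1 := hM w hw
      rw [hfg w, norm_mul] at h1
      have h2 : R - r ≤ ‖w - u‖ := by
        have := norm_sub_norm_le w u
        linarith
      rw [le_div_iff₀ (by linarith), mul_comm]
      exact (mul_le_mul_of_nonneg_right h2 (norm_nonneg _)).trans h1
    have hgz := ih g _ s hgd hs hm' hgM z hz
    rw [hfg z, norm_mul]
    have hzu : ‖z - u‖ ≤ 2 * r := (norm_sub_le z u).trans (by linarith)
    calc ‖z - u‖ * ‖g z‖ ≤ 2 * r * (M / (R - r) * (2 * r / (R - r)) ^ m) := by gcongr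
      _ = _ := by rw [pow_succ]; field_simp

theorem norm_le_of_le_zeroCount {r R M : ℝ} (hr : 0 < r) (hR : r < R) {m : ℕ} {f : ℂ → ℂ}
    (hf : Differentiable ℂ f) (hm : (m : ℕ∞) ≤ zeroCount f r)
    (hM : ∀ z : ℂ, ‖z‖ = R → ‖f z‖ ≤ M) {z : ℂ} (hz : ‖z‖ ≤ r) :
    ‖f z‖ ≤ M * (2 * r / (R - r)) ^ m := by
  rcases Nat.eq_zero_or_pos m with rfl | hm0
  · exact norm_le_of_le_sum_analyticOrderAt hr hR 0 f M ∅ hf (by simp) (by simp) hM z hz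
  · have hlt : ((m - 1 : ℕ) : ℕ∞) < zeroCount f r :=
      lt_of_lt_of_le (by exact_mod_cast Nat.sub_lt hm0 one_pos) hm
    simp only [zeroCount, lt_iSup_iff] at hlt
    obtain ⟨s, hs, hlt⟩ := hlt
    refine norm_le_of_le_sum_analyticOrderAt hr hR m f M s hf hs ?_ hM z hz
    have := Order.add_one_le_of_lt hlt
    rwa [← Nat.cast_add_one, Nat.sub_add_cancel hm0] at this

/-! ### Jensen's formula and Rouché's theorem -/

/-- **Jensen's formula** as a count of zeros: near `r` from the left, the circle averages of
`log ‖f‖` grow like `N log ρ`, where `N` is the number of zeros in the open disk of radius `r`. -/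
theorem exists_zeroCount_eq_and_circleAverage_sub {f : ℂ → ℂ} (hf : Differentiable ℂ f)
    (h0 : f ≠ 0) {r : ℝ} (hr : 0 < r) :
    ∃ N : ℕ, zeroCount f r = N ∧ ∃ δ, 0 < δ ∧ δ < r ∧ ∀ ρ, δ ≤ ρ → ρ ≤ r →
      Real.circleAverage (fun z => Real.log ‖f z‖) 0 r -
        Real.circleAverage (fun z => Real.log ‖f z‖) 0 ρ = N * (Real.log r - Real.log ρ) := by
  classical
  have han : ∀ z, AnalyticAt ℂ f z := hf.analyticAt
  have htop : ∀ z, analyticOrderAt f z ≠ ⊤ := fun z h =>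
    h0 ((AnalyticOnNhd.analyticOrderAt_eq_top_iff_eq_zero z han).1 h)
  have hnat : ∀ z, analyticOrderAt f z = (analyticOrderNatAt f z : ℕ∞) := fun z =>
    (Nat.cast_analyticOrderNatAt (htop z)).symm
  have hdiv : ∀ ρ u, u ∈ Metric.closedBall (0 : ℂ) |ρ| →
      MeromorphicOn.divisor f (Metric.closedBall 0 |ρ|) u = (analyticOrderNatAt f u : ℤ) := by
    intro ρ u hu
    rw [MeromorphicOn.AnalyticOnNhd.divisor_apply (fun z _ => han z) hu, hnat]
    rfl
  have hfin := (MeromorphicOn.divisor f (Metric.closedBall (0 : ℂ) |r|)).finiteSupport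
    (isCompact_closedBall _ _)
  set S : Finset ℂ := hfin.toFinset.filter fun z => ‖z‖ < r with hS
  have hmemS : ∀ u : ℂ, u ∈ S ↔ analyticOrderNatAt f u ≠ 0 ∧ ‖u‖ < r := by
    intro u
    simp only [hS, Finset.mem_filter, Set.Finite.mem_toFinset, Function.mem_support]
    refine and_congr_left fun hu => ?_
    rw [hdiv r u (by simpa [abs_of_pos hr] using hu.le)]
    simp
  refine ⟨∑ u ∈ S, analyticOrderNatAt f u, ?_, ?_⟩
  · refine le_antisymm (iSup₂_le fun s hs => ?_) ?_
    · calc ∑ z ∈ s, analyticOrderAt f z = ∑ z ∈ s with z ∈ S, analyticOrderAt f z := by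
            refine (Finset.sum_filter_of_ne fun z hz hne => ?_).symm
            rw [hmemS]
            refine ⟨fun h => hne ?_, by simpa using hs hz⟩
            rw [hnat, h, Nat.cast_zero]
        _ ≤ ∑ z ∈ S, analyticOrderAt f z :=
            Finset.sum_le_sum_of_subset fun z hz => (Finset.mem_filter.1 hz).2
        _ = _ := by push_cast; exact Finset.sum_congr rfl fun z _ => hnat z
    · refine le_trans (le_of_eq ?_) (le_iSup₂ (f := fun (s : Finset ℂ)
        (_ : (s : Set ℂ) ⊆ Metric.ball 0 r) => ∑ z ∈ s, analyticOrderAt f z) S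
        fun u hu => by simpa using ((hmemS u).1 hu).2)
      push_cast
      exact Finset.sum_congr rfl fun z _ => (hnat z).symm
  -- Zeros on the circle of radius `ρ` contribute `log ρ - log ρ = 0`, so summing over `S` suffices.
  -- A zero at the origin fits the same sum because `Real.log 0 = 0`.
  have key : ∀ ρ, 0 < ρ → ρ ≤ r → (∀ u ∈ S, ‖u‖ ≤ ρ) →
      Real.circleAverage (fun z => Real.log ‖f z‖) 0 ρ =
        ∑ u ∈ S, (analyticOrderNatAt f u : ℝ) * (Real.log ρ - Real.log ‖u‖) +
          Real.log ‖meromorphicTrailingCoeffAt f 0‖ := by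
    intro ρ hρ hρr hSρ
    have hfinρ := (MeromorphicOn.divisor f (Metric.closedBall (0 : ℂ) |ρ|)).finiteSupport
      (isCompact_closedBall _ _)
    rw [MeromorphicOn.circleAverage_log_norm hρ.ne' fun z _ => (han z).meromorphicAt,
      ← countingFunction_finsum_eq_finsum_add hρ.ne' hfinρ]
    congr 1
    rw [finsum_eq_sum_of_support_subset (s := S)]
    · refine Finset.sum_congr rfl fun u hu => ?_
      rw [hdiv ρ u (by simpa [abs_of_pos hρ] using hSρ u hu), zero_sub, norm_neg]
      norm_cast
    · intro u hu
      simp only [Function.mem_support, ne_eq, mul_eq_zero, not_or, zero_sub, norm_neg] at hu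
      have hmem : u ∈ Metric.closedBall (0 : ℂ) |ρ| := by
        by_contra hmem
        exact hu.1 (by simp [Function.locallyFinsuppWithin.apply_eq_zero_of_notMem _ hmem])
      have hle : ‖u‖ ≤ ρ := by simpa [abs_of_pos hρ] using hmem
      have hne : ‖u‖ ≠ ρ := fun h => hu.2 (by rw [h, sub_self])
      refine (hmemS u).2 ⟨fun h => hu.1 ?_, (lt_of_le_of_ne hle hne).trans_le hρr⟩
      rw [hdiv ρ u hmem, h]
      simp
  -- The threshold is the largest modulus of a zero in the open disk; `r / 2` keeps it positive.
  set T : Finset ℝ := insert (r / 2) (S.image norm) with hT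
  have hTne : T.Nonempty := Finset.insert_nonempty _ _
  have hδ : T.max' hTne < r := by
    rw [Finset.max'_lt_iff]
    intro x hx
    rw [hT, Finset.mem_insert, Finset.mem_image] at hx
    rcases hx with rfl | ⟨u, hu, rfl⟩
    · linarith
    · exact ((hmemS u).1 hu).2
  have hδ0 : r / 2 ≤ T.max' hTne := Finset.le_max' _ _ (Finset.mem_insert_self _ _)
  refine ⟨T.max' hTne, by linarith, hδ, fun ρ h1 h2 => ?_⟩
  rw [key r hr le_rfl fun u hu => ((hmemS u).1 hu).2.le,
    key ρ (by linarith) h2 fun u hu => (Finset.le_max' _ _ (Finset.mem_insert_of_mem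
      (Finset.mem_image_of_mem _ hu))).trans h1]
  rw [add_sub_add_right_eq_sub, ← Finset.sum_sub_distrib]
  push_cast
  rw [Finset.sum_mul]
  exact Finset.sum_congr rfl fun u _ => by ring

/-- The quotient `q = f / (a z^m)` stays within distance `1` of `1`, so `log q` is holomorphic on
the annulus and its circle average does not depend on the radius. Only `log ‖a z^m‖` varies. -/
theorem circleAverage_log_norm_eq_of_norm_sub_lt {f : ℂ → ℂ} (hf : Differentiable ℂ f) {a : ℂ}
    {m : ℕ} {r ρ : ℝ} (hρ : 0 < ρ) (hρr : ρ ≤ r)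
    (hdom : ∀ z : ℂ, ρ ≤ ‖z‖ → ‖z‖ ≤ r → ‖f z - a * z ^ m‖ < ‖a * z ^ m‖) :
    Real.circleAverage (fun z => Real.log ‖f z‖) 0 r -
      Real.circleAverage (fun z => Real.log ‖f z‖) 0 ρ = m * (Real.log r - Real.log ρ) := by
  set q : ℂ → ℂ := fun z => f z / (a * z ^ m) with hq
  have hne : ∀ z : ℂ, ρ ≤ ‖z‖ → ‖z‖ ≤ r → a * z ^ m ≠ 0 := fun z h1 h2 =>
    norm_pos_iff.1 ((norm_nonneg _).trans_lt (hdom z h1 h2))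
  have hslit : ∀ z : ℂ, ρ ≤ ‖z‖ → ‖z‖ ≤ r → q z ∈ Complex.slitPlane := by
    intro z h1 h2
    refine Complex.ball_one_subset_slitPlane ?_
    rw [mem_ball_iff_norm, show q z - 1 = (f z - a * z ^ m) / (a * z ^ m) by
      rw [sub_div, div_self (hne z h1 h2)], norm_div,
      div_lt_one (norm_pos_iff.2 (hne z h1 h2))]
    exact hdom z h1 h2
  have hdiff : ∀ z : ℂ, ρ ≤ ‖z‖ → ‖z‖ ≤ r → DifferentiableAt ℂ (fun z => Complex.log (q z)) z :=
    fun z h1 h2 => ((hf z).div (by fun_prop) (hne z h1 h2)).clog (hslit z h1 h2)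
  have hint : ∀ R, ρ ≤ R → R ≤ r → CircleIntegrable (fun z => Complex.log (q z)) 0 R := by
    intro R h1 h2
    refine ContinuousOn.circleIntegrable (by linarith) fun z hz => ?_
    have hz' : ‖z‖ = R := by simpa using hz
    exact (hdiff z (by linarith) (by linarith)).continuousAt.continuousWithinAt
  have hcirc : ∀ R, ρ ≤ R → R ≤ r → Real.circleAverage (fun z => Real.log ‖f z‖) 0 R =
      (Real.circleAverage (fun z => Complex.log (q z)) 0 R).re + (Real.log ‖a‖ + m * Real.log R) := by
    intro R h1 h2
    have hR : 0 < R := by linarith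
    have e1 := Complex.reCLM.circleAverage_comp_comm (hint R h1 h2)
    rw [Complex.reCLM_apply] at e1
    rw [← e1, ← Real.circleAverage_const (Real.log ‖a‖ + m * Real.log R) (0 : ℂ) R,
      ← Real.circleAverage_add]
    · refine Real.circleAverage_congr_sphere fun z hz => ?_
      have hz' : ‖z‖ = R := by simpa [abs_of_pos hR] using hz
      have hz1 := hne z (by linarith) (by linarith)
      have hq0 : q z ≠ 0 := Complex.slitPlane_ne_zero (hslit z (by linarith) (by linarith))
      have ha : ‖a‖ ≠ 0 := norm_ne_zero_iff.2 (left_ne_zero_of_mul hz1)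
      have hfz : f z = q z * (a * z ^ m) := (div_mul_cancel₀ _ hz1).symm
      simp only [Pi.add_apply, Function.comp_apply, Complex.reCLM_apply, Complex.log_re]
      rw [hfz, norm_mul, Real.log_mul (norm_ne_zero_iff.2 hq0) (norm_ne_zero_iff.2 hz1), norm_mul,
        norm_pow, hz', Real.log_mul ha (by positivity), Real.log_pow]
    · exact ContinuousOn.circleIntegrable hR.le
        (Complex.continuous_re.comp_continuousOn fun z hz => by
          have hz' : ‖z‖ = R := by simpa using hz
          exact (hdiff z (by linarith) (by linarith)).continuousAt.continuousWithinAt)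
    · exact circleIntegrable_const _ _ _
  have hann := Complex.circleIntegral_sub_center_inv_smul_eq_of_differentiable_on_annulus_off_countable
    (c := 0) hρ hρr (f := fun z => Complex.log (q z)) Set.countable_empty
    (fun z hz => (hdiff z (by simpa using hz.2)
      (by simpa using hz.1)).continuousAt.continuousWithinAt)
    (fun z hz => hdiff z (by simpa using (not_le.1 (by simpa using hz.1.2)).le)
      (by simpa using (mem_ball_zero_iff.1 hz.1.1).le))
  rw [hcirc r hρr le_rfl, hcirc ρ le_rfl hρr,
    Real.circleAverage_eq_circleIntegral (hρ.trans_le hρr).ne',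
    Real.circleAverage_eq_circleIntegral hρ.ne', hann]
  ring

/-- **Rouché's theorem** for comparison with a monomial on an annulus. -/
theorem zeroCount_eq_of_norm_sub_lt {f : ℂ → ℂ} (hf : Differentiable ℂ f) {a : ℂ}
    {m : ℕ} {r ρ : ℝ} (hρ : 0 < ρ) (hρr : ρ < r)
    (hdom : ∀ z : ℂ, ρ ≤ ‖z‖ → ‖z‖ ≤ r → ‖f z - a * z ^ m‖ < ‖a * z ^ m‖) :
    zeroCount f r = m := by
  have hr : 0 < r := hρ.trans hρr
  have h0 : f ≠ 0 := by
    rintro rfl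
    have := hdom (r : ℂ) (by simpa [abs_of_pos hr] using hρr.le) (by simp [abs_of_pos hr])
    simp at this
  obtain ⟨N, hN, δ, hδ0, hδr, hδ⟩ := exists_zeroCount_eq_and_circleAverage_sub hf h0 hr
  -- At a radius where both formulas apply, the increment is `N` and also `m` times the same nonzero
  -- number.
  have h1 := hδ (max δ ρ) (le_max_left _ _) (max_lt hδr hρr).le
  rw [circleAverage_log_norm_eq_of_norm_sub_lt hf (lt_max_of_lt_left hδ0) (max_lt hδr hρr).le
    fun z h1 h2 => hdom z ((le_max_right _ _).trans h1) h2] at h1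
  have h2 : Real.log r - Real.log (max δ ρ) ≠ 0 :=
    (sub_pos.2 (Real.log_lt_log (lt_max_of_lt_left hδ0) (max_lt hδr hρr))).ne'
  rw [hN, ← Nat.cast_inj (R := ℝ).1 (mul_right_cancel₀ h2 h1)]

/-! ### Geometric growth of Gaussian coefficients -/

theorem gaussianSeqLaw_exists_norm_gt_le (j : ℕ → ℕ) {t : ℝ} (ht : 1 ≤ t) :
    gaussianSeqLaw {c | ∃ n, t * 2 ^ n < ‖c (j n)‖} ≤ ENNReal.ofReal (4 * Real.exp (-t ^ 2 / 2)) := by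
  have hsum : HasSum (fun n : ℕ => 2 * Real.exp (-t ^ 2 / 2) * (1 / 2) ^ n)
      (4 * Real.exp (-t ^ 2 / 2)) := by
    rw [show 4 * Real.exp (-t ^ 2 / 2) = 2 * Real.exp (-t ^ 2 / 2) * 2 by ring]
    exact hasSum_geometric_two.mul_left _
  rw [Set.ofPred_exists, ← hsum.tsum_eq, ENNReal.ofReal_tsum_of_nonneg (fun n => by positivity)
    hsum.summable]
  refine (measure_iUnion_le _).trans (ENNReal.tsum_le_tsum fun n => ?_)
  have h1 : gaussianSeqLaw {c | t * 2 ^ n < ‖c (j n)‖} ≤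
      gaussianSeqLaw {c | c (j n) ∈ {z : ℂ | t * 2 ^ n ≤ ‖z‖}} :=
    measure_mono fun c (hc : t * 2 ^ n < ‖c (j n)‖) => hc.le
  rw [gaussianSeqLaw_eval_preimage _ (measurableSet_le measurable_const measurable_norm)] at h1
  refine h1.trans ((stdComplexGaussian_compl_ball_le _ (by positivity)).trans
    (ENNReal.ofReal_le_ofReal ?_))
  rw [mul_assoc]
  gcongr
  have h2 : Real.exp (-1) ≤ 1 / 2 := by
    rw [Real.exp_neg, one_div]
    gcongr
    linarith [Real.add_one_le_exp (1 : ℝ)]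
  calc Real.exp (-(t * 2 ^ n) ^ 2 / 2) ≤ Real.exp (-t ^ 2 / 2 + n * (-1)) := by
        rw [Real.exp_le_exp]
        -- Bernoulli's inequality for `4^n` turns the tails into a geometric series with ratio at
        -- most `e⁻¹ ≤ 1/2`.
        have h3 : 1 + (n : ℝ) * 3 ≤ (1 + 3) ^ n := one_add_mul_le_pow (by norm_num) n
        have h4 : (t * 2 ^ n) ^ 2 = t ^ 2 * (1 + 3) ^ n := by
          rw [mul_pow, ← pow_mul, mul_comm n 2, pow_mul]; norm_num
        have h5 : (1 : ℝ) ≤ t ^ 2 := one_le_pow₀ ht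
        have h6 : (0 : ℝ) ≤ n := n.cast_nonneg
        nlinarith [mul_le_mul_of_nonneg_left h3 (by positivity : 0 ≤ t ^ 2), mul_nonneg h6
          (sub_nonneg.2 h5)]
    _ ≤ Real.exp (-t ^ 2 / 2) * (1 / 2) ^ n := by
        rw [Real.exp_add, Real.exp_nat_mul]
        gcongr

/-- Sequences of at most geometric growth with ratio `2`. -/
def geometricGrowth : Set (ℕ → ℂ) := {c | ∃ K : ℕ, ∀ n, ‖c n‖ ≤ K * 2 ^ n}

theorem measurableSet_geometricGrowth : MeasurableSet geometricGrowth := by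
  unfold geometricGrowth
  rw [Set.ofPred_exists]
  refine MeasurableSet.iUnion fun K => ?_
  rw [Set.ofPred_forall]
  exact MeasurableSet.iInter fun n =>
    measurableSet_le (measurable_pi_apply n).norm measurable_const

theorem ae_mem_geometricGrowth : ∀ᵐ c ∂gaussianSeqLaw, c ∈ geometricGrowth := by
  rw [ae_iff]
  have hlim : Tendsto (fun K : ℕ => ENNReal.ofReal (4 * Real.exp (-(K : ℝ) ^ 2 / 2))) atTop
      (𝓝 0) := by
    rw [← ENNReal.ofReal_zero]
    refine ENNReal.tendsto_ofReal ?_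
    rw [← mul_zero (4 : ℝ)]
    refine (Real.tendsto_exp_atBot.comp ?_).const_mul 4
    have : Tendsto (fun K : ℕ => (K : ℝ) ^ 2 / 2) atTop atTop :=
      ((tendsto_pow_atTop two_ne_zero).comp tendsto_natCast_atTop_atTop).atTop_div_const two_pos
    refine (tendsto_neg_atTop_atBot.comp this).congr fun K => ?_
    simp [neg_div]
  refine le_antisymm (ge_of_tendsto hlim ?_) zero_le
  filter_upwards [eventually_ge_atTop 1] with K hK
  refine le_trans (measure_mono fun c hc => ?_)
    (gaussianSeqLaw_exists_norm_gt_le (fun n => n) (t := K) (by exact_mod_cast hK))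
  by_contra h
  refine hc ⟨K, fun n => ?_⟩
  by_contra h'
  exact h ⟨n, not_le.1 h'⟩

/-! ### Measurability of the zero count -/

open Classical in
/-- Replace a sequence by `0` unless it has at most geometric growth. -/
noncomputable def growthTruncation (c : ℕ → ℂ) : ℕ → ℂ := if c ∈ geometricGrowth then c else 0

theorem growthTruncation_of_mem {c : ℕ → ℂ} (h : c ∈ geometricGrowth) :
    growthTruncation c = c := if_pos h

theorem measurable_growthTruncation : Measurable growthTruncation :=
  Measurable.ite measurableSet_geometricGrowth measurable_id measurable_const

theorem exists_norm_growthTruncation_le (c : ℕ → ℂ) :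
    ∃ K : ℝ, ∀ n, ‖growthTruncation c n‖ ≤ K * 2 ^ n := by
  unfold growthTruncation
  split_ifs with h
  · obtain ⟨K, hK⟩ := h
    exact ⟨K, hK⟩
  · exact ⟨0, by simp⟩

theorem measurable_planarSeries_growthTruncation :
    Measurable fun p : (ℕ → ℂ) × ℂ => planarSeries (growthTruncation p.1) p.2 := by
  refine measurable_of_tendsto_metrizable (f := fun N (p : (ℕ → ℂ) × ℂ) =>
    ∑ n ∈ Finset.range N, growthTruncation p.1 n * p.2 ^ n / ((√(n ! : ℝ) : ℝ) : ℂ)) (fun N => ?_) ?_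
  · refine Finset.measurable_fun_sum _ fun n _ => ?_
    exact ((((measurable_pi_apply n).comp (measurable_growthTruncation.comp measurable_fst))).mul
      (measurable_snd.pow_const n)).div_const _
  · rw [tendsto_pi_nhds]
    intro p
    obtain ⟨K, hK⟩ := exists_norm_growthTruncation_le p.1
    exact (summable_planarSeries_term hK p.2).hasSum.tendsto_sum_nat

theorem measurable_circleAverage_log_planarSeries (ρ : ℝ) :
    Measurable fun c => Real.circleAverage
      (fun z => Real.log ‖planarSeries (growthTruncation c) z‖) 0 ρ := by
  have h : Measurable fun p : (ℕ → ℂ) × ℝ =>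
      Real.log ‖planarSeries (growthTruncation p.1) (circleMap 0 ρ p.2)‖ :=
    (measurable_planarSeries_growthTruncation.comp (measurable_fst.prodMk
      ((continuous_circleMap 0 ρ).measurable.comp measurable_snd))).norm.log
  simp only [Real.circleAverage_def, intervalIntegral.integral_of_le Real.two_pi_pos.le]
  have h' := (h.stronglyMeasurable.integral_prod_right'
    (ν := volume.restrict (Set.Ioc 0 (2 * Real.pi)))).measurable
  exact h'.const_smul ((2 * Real.pi)⁻¹ : ℝ)

/-- For a nonzero series, Jensen's formula makes the event equivalent to an inequality between
measurable circle averages, eventually along radii increasing to `r`. The zero series, with infinite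
count, is split off. -/
theorem measurableSet_le_zeroCount_growthTruncation {r : ℝ} (hr : 0 < r) (m : ℕ) :
    MeasurableSet {c | (m : ℕ∞) ≤ zeroCount (planarSeries (growthTruncation c)) r} := by
  set A : ℝ → (ℕ → ℂ) → ℝ := fun ρ c => Real.circleAverage
      (fun z => Real.log ‖planarSeries (growthTruncation c) z‖) 0 ρ with hA
  obtain ⟨ρ, -, hρr, hρ⟩ := exists_seq_strictMono_tendsto r
  have hset : {c | (m : ℕ∞) ≤ zeroCount (planarSeries (growthTruncation c)) r} =
      {c | growthTruncation c = 0 ∧ (m : ℕ∞) ≤ zeroCount (planarSeries 0) r} ∪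
        {c | growthTruncation c ≠ 0 ∧ ∃ k, ∀ j ≥ k,
          (m : ℝ) * (Real.log r - Real.log (ρ j)) ≤ A r c - A (ρ j) c} := by
    ext c
    simp only [Set.mem_union, Set.mem_ofPred_eq]
    by_cases h0 : growthTruncation c = 0
    · simp [h0]
    · simp only [h0, false_and, false_or, ne_eq, not_false_eq_true, true_and]
      obtain ⟨K, hK⟩ := exists_norm_growthTruncation_le c
      obtain ⟨N, hN, δ, hδ0, hδr, hδ⟩ := exists_zeroCount_eq_and_circleAverage_sub
        (differentiable_planarSeries hK) (fun h => h0 ((planarSeries_eq_zero_iff hK).1 h)) hr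
      have hev : ∀ᶠ j in atTop, ((m : ℝ) * (Real.log r - Real.log (ρ j)) ≤
          A r c - A (ρ j) c ↔ m ≤ N) := by
        filter_upwards [hρ.eventually_const_le hδr] with j hj
        rw [hA]
        simp only
        rw [hδ _ hj (hρr j).le, mul_le_mul_iff_left₀, Nat.cast_le]
        exact sub_pos.2 (Real.log_lt_log (hδ0.trans_le hj) (hρr j))
      rw [← eventually_atTop, eventually_congr hev, eventually_const, hN, Nat.cast_le]
  rw [hset]
  have hz : MeasurableSet {c | growthTruncation c = 0} :=
    measurable_growthTruncation (measurableSet_singleton 0)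
  refine (hz.inter (MeasurableSet.const _)).union (hz.compl.inter ?_)
  change MeasurableSet {c | ∃ k, ∀ j ≥ k,
    (m : ℝ) * (Real.log r - Real.log (ρ j)) ≤ A r c - A (ρ j) c}
  simp only [Set.ofPred_exists, Set.ofPred_forall]
  exact MeasurableSet.iUnion fun k => MeasurableSet.iInter fun j => MeasurableSet.iInter fun _ =>
    measurableSet_le measurable_const ((measurable_circleAverage_log_planarSeries r).sub
      (measurable_circleAverage_log_planarSeries (ρ j)))

/-- Truncation changes the series only on a null set; null measurability is enough to pull the event
back along the law of the coefficients. -/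
theorem nullMeasurableSet_le_zeroCount {r : ℝ} (hr : 0 < r) (m : ℕ) :
    NullMeasurableSet {c | (m : ℕ∞) ≤ zeroCount (planarSeries c) r} gaussianSeqLaw := by
  refine (measurableSet_le_zeroCount_growthTruncation hr m).nullMeasurableSet.congr ?_
  filter_upwards [ae_mem_geometricGrowth] with c hc
  change (_ ≤ zeroCount (planarSeries (growthTruncation c)) r) = _
  rw [growthTruncation_of_mem hc]
  rfl

theorem overcrowdingProb_eq_gaussianSeqLaw {Ω : Type u} [MeasurableSpace Ω] {P : Measure Ω}
    {a : ℕ → Ω → ℂ} (h : IsIIDStdComplexGaussian P a) {r : ℝ} (hr : 0 < r) (m : ℕ) :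
    overcrowdingProb P a r m =
      gaussianSeqLaw.real {c | (m : ℕ∞) ≤ zeroCount (planarSeries c) r} := by
  have hlaw := hasLaw_gaussianSeqLaw h
  have hm := nullMeasurableSet_le_zeroCount hr m
  rw [← hlaw.map_eq] at hm
  rw [measureReal_def, ← hlaw.map_eq, Measure.map_apply₀ hlaw.aemeasurable hm]
  rfl

/-! ### Upper bound -/

theorem norm_coeff_le_of_le_zeroCount {r : ℝ} (hr : 0 < r) {m : ℕ} (hm : 1 ≤ m) {c : ℕ → ℂ} {K : ℝ}
    (hc : ∀ n, ‖c n‖ ≤ K * 2 ^ n) (hz : (m : ℕ∞) ≤ zeroCount (planarSeries c) r) (n : ℕ) :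
    ‖c n‖ ≤ √(n ! : ℝ) * (2 * K * Real.exp (32 * r ^ 2 * m) * (2 / √m) ^ m) / r ^ n := by
  have hK : 0 ≤ K := by simpa using (norm_nonneg (c 0)).trans (hc 0)
  have hm1 : (1 : ℝ) ≤ √m := Real.one_le_sqrt.2 (by exact_mod_cast hm)
  have hrm : r ≤ r * √m := le_mul_of_one_le_right hr.le hm1
  -- A radius of order `√m` keeps the growth factor `exp (8R²)` at `e^{O(m)}` while each zero gains
  -- a factor `2/√m`.
  have hR : r < 2 * r * √m := by linarith
  refine norm_coeff_planarSeries_le hc hr (fun z hzr => ?_) n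
  refine (norm_le_of_le_zeroCount hr hR (differentiable_planarSeries hc) hz
    (fun w hw => norm_planarSeries_le hc hw.le) hzr.le).trans ?_
  have hsq : 8 * (2 * r * √m) ^ 2 = 32 * r ^ 2 * m := by
    rw [mul_pow, Real.sq_sqrt m.cast_nonneg]; ring
  rw [hsq]
  have hpos : 0 < 2 * r * √m - r := by linarith
  have hratio : 2 * r / (2 * r * √m - r) ≤ 2 / √m := by
    rw [div_le_div_iff₀ hpos (by linarith)]
    linarith
  have : (2 * r / (2 * r * √m - r)) ^ m ≤ (2 / √m) ^ m :=
    pow_le_pow_left₀ (div_nonneg (by linarith) hpos.le) hratio m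
  calc _ ≤ K * Real.exp (32 * r ^ 2 * m) * 2 * (2 / √m) ^ m := by gcongr
    _ = _ := by ring

theorem sq_coeff_bound_le {r : ℝ} (hr : 0 < r) {m n : ℕ} (hm : 1 ≤ m) (hn : n < m) :
    (√(n ! : ℝ) * (2 * (m : ℝ) ^ 2 * Real.exp (32 * r ^ 2 * m) * (2 / √m) ^ m) / r ^ n) ^ 2 ≤
      Real.exp (n * Real.log m + ((8 + 64 * r ^ 2 + 2 * |Real.log r|) * m - m * Real.log m)) := by
  have hm0 : (0 : ℝ) < m := by exact_mod_cast hm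
  have hm1 : (1 : ℝ) ≤ m := by exact_mod_cast hm
  have hlog2 : Real.log 2 ≤ 1 := (Real.log_le_sub_one_of_pos two_pos).trans (by norm_num)
  have hlogm : Real.log m ≤ m - 1 := Real.log_le_sub_one_of_pos hm0
  have hfac : Real.log (n ! : ℝ) ≤ n * Real.log m := by
    rw [← Real.log_pow]
    refine Real.log_le_log (by positivity) ?_
    calc (n ! : ℝ) ≤ (n : ℝ) ^ n := by exact_mod_cast Nat.factorial_le_pow n
      _ ≤ (m : ℝ) ^ n := by gcongr
  have hfac' : Real.log (√(n ! : ℝ)) = Real.log (n ! : ℝ) / 2 := Real.log_sqrt (by positivity)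
  have hsqm : Real.log (√(m : ℝ)) = Real.log (m : ℝ) / 2 := Real.log_sqrt hm0.le
  have hs : (0 : ℝ) < √m := Real.sqrt_pos.2 hm0
  have hnr : -(n * Real.log r) ≤ m * |Real.log r| := by
    rw [← mul_neg]
    calc (n : ℝ) * -Real.log r ≤ n * |Real.log r| := by
          gcongr; exact neg_le_abs _
      _ ≤ _ := by gcongr
  rw [← Real.log_le_iff_le_exp (by positivity), Real.log_pow, Real.log_div (by positivity)
    (by positivity), Real.log_mul (by positivity) (by positivity), Real.log_mul (by positivity)
    (by positivity), Real.log_mul (by positivity) (by positivity), Real.log_mul (by positivity)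
    (by positivity), Real.log_exp, Real.log_pow, Real.log_pow, Real.log_pow,
    Real.log_div (by positivity) (by positivity), hfac', hsqm]
  push_cast
  nlinarith [mul_le_mul_of_nonneg_left hlog2 hm0.le]

theorem gaussianSeqLaw_closedBall_le {m : ℕ} {ρ : ℕ → ℝ} (hρ : ∀ n, 0 ≤ ρ n) :
    gaussianSeqLaw {c | ∀ n < m, ‖c n‖ ≤ ρ n} ≤
      ENNReal.ofReal (∏ n ∈ Finset.range m, ρ n ^ 2) := by
  have h := Measure.infinitePi_pi (fun _ : ℕ => stdComplexGaussian) (s := Finset.range m)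
    (t := fun n => Metric.closedBall 0 (ρ n)) fun n _ => measurableSet_closedBall
  have hset : {c : ℕ → ℂ | ∀ n < m, ‖c n‖ ≤ ρ n} =
      Set.pi (Finset.range m) fun n => Metric.closedBall 0 (ρ n) := by
    ext c; simp [Set.mem_pi]
  rw [hset, gaussianSeqLaw, h, ENNReal.ofReal_prod_of_nonneg fun n _ => sq_nonneg _]
  exact Finset.prod_le_prod' fun n _ => stdComplexGaussian_closedBall_le _ (hρ n)

theorem sum_range_cast_mul_two (m : ℕ) :
    (∑ n ∈ Finset.range m, (n : ℝ)) * 2 = m * (m - 1) := by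
  induction m with
  | zero => simp
  | succ k ih =>
    rw [Finset.sum_range_succ, add_mul, ih]
    push_cast
    ring

theorem prod_exp_mul_log_le (m : ℕ) (C : ℝ) :
    ∏ n ∈ Finset.range m, Real.exp (n * Real.log m + (C * m - m * Real.log m)) ≤
      Real.exp (-(1 / 2) * (m : ℝ) ^ 2 * Real.log m + C * (m : ℝ) ^ 2) := by
  rw [← Real.exp_sum, Real.exp_le_exp, Finset.sum_add_distrib, ← Finset.sum_mul]
  have h1 : (∑ n ∈ Finset.range m, (n : ℝ)) ≤ (m : ℝ) ^ 2 / 2 := by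
    nlinarith [sum_range_cast_mul_two m, m.cast_nonneg (α := ℝ)]
  have hlog : 0 ≤ Real.log m := Real.log_natCast_nonneg m
  simp only [Finset.sum_const, Finset.card_range, nsmul_eq_mul]
  nlinarith [mul_le_mul_of_nonneg_right h1 hlog]

theorem exists_gaussianSeqLaw_le_zeroCount_le {r : ℝ} (hr : 0 < r) : ∃ C : ℝ, 0 ≤ C ∧
    ∀ m : ℕ, 1 ≤ m → gaussianSeqLaw.real {c | (m : ℕ∞) ≤ zeroCount (planarSeries c) r} ≤
      5 * Real.exp (-(1 / 2) * (m : ℝ) ^ 2 * Real.log m + C * (m : ℝ) ^ 2) := by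
  refine ⟨8 + 64 * r ^ 2 + 2 * |Real.log r|, by positivity, fun m hm => ?_⟩
  set C := 8 + 64 * r ^ 2 + 2 * |Real.log r|
  have hC : 0 ≤ C := by positivity
  have hm1 : (1 : ℝ) ≤ m := by exact_mod_cast hm
  have hm0 : (0 : ℝ) < m := by linarith
  set ρ : ℕ → ℝ := fun n =>
    √(n ! : ℝ) * (2 * (m : ℝ) ^ 2 * Real.exp (32 * r ^ 2 * m) * (2 / √m) ^ m) / r ^ n with hρ
  have hsub : {c | (m : ℕ∞) ≤ zeroCount (planarSeries c) r} ⊆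
      {c | ∃ n, (m : ℝ) ^ 2 * 2 ^ n < ‖c (id n)‖} ∪ {c | ∀ n < m, ‖c n‖ ≤ ρ n} := by
    intro c hc
    by_cases h : ∃ n, (m : ℝ) ^ 2 * 2 ^ n < ‖c (id n)‖
    · exact Or.inl h
    · push Not at h
      exact Or.inr fun n _ => norm_coeff_le_of_le_zeroCount hr hm h hc n
  have h1 := gaussianSeqLaw_exists_norm_gt_le id (t := (m : ℝ) ^ 2) (one_le_pow₀ hm1)
  have h2 := gaussianSeqLaw_closedBall_le (m := m) (ρ := ρ) fun n => by positivity
  have h3 : ∏ n ∈ Finset.range m, ρ n ^ 2 ≤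
      Real.exp (-(1 / 2) * (m : ℝ) ^ 2 * Real.log m + C * (m : ℝ) ^ 2) :=
    (Finset.prod_le_prod (fun n _ => sq_nonneg _) fun n hn =>
      sq_coeff_bound_le hr hm (Finset.mem_range.1 hn)).trans (prod_exp_mul_log_le m C)
  -- The exceptional event, of order `exp (-m⁴/2)`, is negligible since `log m ≤ m²`.
  have h4 : 4 * Real.exp (-((m : ℝ) ^ 2) ^ 2 / 2) ≤
      4 * Real.exp (-(1 / 2) * (m : ℝ) ^ 2 * Real.log m + C * (m : ℝ) ^ 2) := by
    gcongr
    have h5 : Real.log m ≤ (m : ℝ) ^ 2 := by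
      have := Real.log_le_sub_one_of_pos hm0
      nlinarith
    have h6 := mul_le_mul_of_nonneg_left h5 (sq_nonneg (m : ℝ))
    have h7 : 0 ≤ C * (m : ℝ) ^ 2 := by positivity
    nlinarith
  refine ENNReal.toReal_le_of_le_ofReal (by positivity) ?_
  calc gaussianSeqLaw {c | (m : ℕ∞) ≤ zeroCount (planarSeries c) r}
      ≤ _ := (measure_mono hsub).trans (measure_union_le _ _)
    _ ≤ _ := add_le_add (h1.trans (ENNReal.ofReal_le_ofReal h4))
        (h2.trans (ENNReal.ofReal_le_ofReal h3))
    _ = _ := by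
        rw [← ENNReal.ofReal_add (by positivity) (by positivity)]
        congr 1
        ring

/-! ### Lower bound -/

/-- The measure of a full product set is the infimum of its finite subproducts. In each of these,
the factors with index at least `N` multiply to at least the probability of the tail event. -/
theorem prod_mul_gaussianSeqLaw_le {t : ℕ → Set ℂ} (ht : ∀ n, MeasurableSet (t n)) (N : ℕ) :
    (∏ n ∈ Finset.range N, stdComplexGaussian (t n)) *
      gaussianSeqLaw {c | ∀ k, c (N + k) ∈ t (N + k)} ≤ gaussianSeqLaw (Set.univ.pi t) := by
  classical
  have h := Measure.infinitePi_pi_univ (fun _ : ℕ => stdComplexGaussian) ht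
  rw [gaussianSeqLaw, h, ENNReal.tprod_eq_iInf_prod (fun n => prob_le_one)]
  refine le_iInf fun S => ?_
  calc _ ≤ (∏ n ∈ Finset.range N, stdComplexGaussian (t n)) *
        ∏ n ∈ S \ Finset.range N, stdComplexGaussian (t n) := by
        refine mul_le_mul_right ?_ _
        rw [← Measure.infinitePi_pi (fun _ : ℕ => stdComplexGaussian) fun n _ => ht n]
        refine measure_mono fun c hc n hn => ?_
        have hn' : N ≤ n := by
          simpa using (Finset.mem_sdiff.1 (Finset.mem_coe.1 hn)).2
        obtain ⟨k, rfl⟩ := Nat.exists_eq_add_of_le hn'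
        exact hc k
    _ = ∏ n ∈ Finset.range N ∪ S, stdComplexGaussian (t n) := by
        rw [← Finset.prod_union Finset.disjoint_sdiff, Finset.union_sdiff_self_eq_union]
    _ ≤ ∏ n ∈ S, stdComplexGaussian (t n) :=
        Finset.prod_le_prod_of_subset_of_le_one' Finset.subset_union_right
          fun n _ _ => prob_le_one

theorem half_le_gaussianSeqLaw_forall_norm_le (N : ℕ) :
    ENNReal.ofReal (1 / 2) ≤ gaussianSeqLaw {c | ∀ k : ℕ, ‖c (N + k)‖ ≤ 4 * 2 ^ k} := by
  have h := gaussianSeqLaw_exists_norm_gt_le (fun k => N + k) (t := 4) (by norm_num)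
  have hmeas : MeasurableSet {c : ℕ → ℂ | ∀ k : ℕ, ‖c (N + k)‖ ≤ 4 * 2 ^ k} := by
    rw [Set.ofPred_forall]
    exact MeasurableSet.iInter fun k =>
      measurableSet_le (measurable_pi_apply _).norm measurable_const
  have hcompl : {c : ℕ → ℂ | ∀ k : ℕ, ‖c (N + k)‖ ≤ 4 * 2 ^ k}ᶜ =
      {c | ∃ k : ℕ, 4 * 2 ^ k < ‖c (N + k)‖} := by
    ext c; simp
  have hexp : 4 * Real.exp (-4 ^ 2 / 2) ≤ 1 / 2 := by
    have h8 := Real.add_one_le_exp (8 : ℝ)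
    rw [show (-4 ^ 2 / 2 : ℝ) = -8 by norm_num, Real.exp_neg]
    have : (Real.exp 8)⁻¹ ≤ 9⁻¹ := by gcongr; linarith
    linarith
  rw [← compl_compl {c : ℕ → ℂ | ∀ k : ℕ, ‖c (N + k)‖ ≤ 4 * 2 ^ k},
    prob_compl_eq_one_sub hmeas.compl, hcompl]
  calc ENNReal.ofReal (1 / 2) = 1 - ENNReal.ofReal (1 / 2) := by
        rw [← ENNReal.ofReal_one, ← ENNReal.ofReal_sub _ (by norm_num)]; norm_num
    _ ≤ _ := tsub_le_tsub_left (h.trans (ENNReal.ofReal_le_ofReal hexp)) _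

theorem zeroCount_planarSeries_eq {r s : ℝ} (hs : 0 < s) (hs1 : s ≤ 1) (hsr : s ≤ r / 2) {m : ℕ}
    {c : ℕ → ℂ} (hlow : ∀ n < m, ‖c n‖ ≤ √((n ! : ℝ) / (m ! : ℝ)) * s ^ m)
    (hmid : m + 8 * r * Real.exp (8 * r ^ 2) + 1 ≤ ‖c m‖)
    (hhigh : ∀ k, ‖c (m + 1 + k)‖ ≤ 4 * 2 ^ k) : zeroCount (planarSeries c) r = m := by
  have hr : 0 < r := by linarith
  have hgrowth : ∀ n, ‖c n‖ ≤ (4 + ‖c m‖) * 2 ^ n := by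
    intro n
    have h2 : (1 : ℝ) ≤ 2 ^ n := one_le_pow₀ (by norm_num)
    rcases lt_trichotomy n m with h | rfl | h
    · have h1 : √((n ! : ℝ) / (m ! : ℝ)) ≤ 1 := by
        rw [Real.sqrt_le_one, div_le_one (by positivity)]
        exact_mod_cast Nat.factorial_le h.le
      have h3 : s ^ m ≤ 1 := pow_le_one₀ hs.le hs1
      have h4 := hlow n h
      have h5 : √((n ! : ℝ) / (m ! : ℝ)) * s ^ m ≤ 1 := mul_le_one₀ h1 (by positivity) h3
      nlinarith [norm_nonneg (c m)]
    · nlinarith [norm_nonneg (c n)]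
    · obtain ⟨k, rfl⟩ := Nat.exists_eq_add_of_le (Nat.succ_le_of_lt h)
      have h1 := hhigh k
      have h3 : (2 : ℝ) ^ k ≤ 2 ^ (m.succ + k) := pow_le_pow_right₀ (by norm_num) (by omega)
      have h4 : c (m + 1 + k) = c (m.succ + k) := rfl
      rw [h4] at h1
      nlinarith [norm_nonneg (c m), mul_nonneg (norm_nonneg (c m))
        (pow_nonneg (zero_le_two (α := ℝ)) (m.succ + k))]
  refine zeroCount_eq_of_norm_sub_lt (differentiable_planarSeries hgrowth)
    (a := c m / ((√(m ! : ℝ) : ℝ) : ℂ)) (ρ := r / 2) (by linarith) (by linarith) fun z hz1 hz2 => ?_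
  have hz0 : 0 < ‖z‖ := by linarith
  set b : ℕ → ℂ := fun n => c n * z ^ n / ((√(n ! : ℝ) : ℝ) : ℂ) with hb
  have hsum : Summable b := summable_planarSeries_term hgrowth z
  have hsplit : planarSeries c z - c m / ((√(m ! : ℝ) : ℝ) : ℂ) * z ^ m =
      ∑ n ∈ Finset.range m, b n + ∑' k, b (m + 1 + k) := by
    have h1 := hsum.sum_add_tsum_nat_add (m + 1)
    simp only [add_comm _ (m + 1)] at h1
    rw [show planarSeries c z = ∑' n, b n from rfl, ← h1, Finset.sum_range_succ, hb]
    simp only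
    ring
  set Y : ℝ := ‖z‖ ^ m / √(m ! : ℝ) with hY
  have hY0 : 0 < Y := by positivity
  have hblow : ‖∑ n ∈ Finset.range m, b n‖ ≤ m * Y := by
    refine (norm_sum_le_of_le (f := b) _ (n := fun _ => Y) fun n hn => ?_).trans (by simp)
    have hnm : n < m := Finset.mem_range.1 hn
    rw [hb]
    simp only [norm_div, norm_mul, norm_pow, Complex.norm_real,
      Real.norm_of_nonneg (Real.sqrt_nonneg _)]
    have h1 := hlow n hnm
    -- Uses both bounds on `s`: `s ≤ 1` lowers the exponent to `m - n`, then `s ≤ r/2 ≤ ‖z‖`.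
    have h2 : s ^ m * ‖z‖ ^ n ≤ ‖z‖ ^ m := by
      calc s ^ m * ‖z‖ ^ n ≤ s ^ (m - n) * ‖z‖ ^ n := by
            gcongr ?_ * _
            exact pow_le_pow_of_le_one hs.le hs1 (Nat.sub_le m n)
        _ ≤ ‖z‖ ^ (m - n) * ‖z‖ ^ n := by
            gcongr
            linarith
        _ = ‖z‖ ^ m := by rw [← pow_add, Nat.sub_add_cancel hnm.le]
    rw [Real.sqrt_div (by positivity)] at h1
    have hn0 : (0 : ℝ) < √(n ! : ℝ) := by positivity
    calc ‖c n‖ * ‖z‖ ^ n / √(n ! : ℝ)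
        ≤ √(n ! : ℝ) / √(m ! : ℝ) * s ^ m * ‖z‖ ^ n / √(n ! : ℝ) := by gcongr
      _ = s ^ m * ‖z‖ ^ n / √(m ! : ℝ) := by field_simp
      _ ≤ Y := by rw [hY]; gcongr
  have hbhigh : ‖∑' k, b (m + 1 + k)‖ ≤ 8 * r * Real.exp (8 * r ^ 2) * Y := by
    have hg : HasSum (fun k : ℕ => Y * r * (4 * Real.exp (8 * r ^ 2)) * (1 / 2) ^ k)
        (Y * r * (4 * Real.exp (8 * r ^ 2)) * 2) := hasSum_geometric_two.mul_left _
    refine (tsum_of_norm_bounded hg fun k => ?_).trans (le_of_eq (by ring))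
    have h1 := norm_planarSeries_term_le (c := fun k => c (m + 1 + k)) hhigh hz2 k
    simp only [norm_div, norm_mul, norm_pow, Complex.norm_real,
      Real.norm_of_nonneg (Real.sqrt_nonneg _)] at h1
    rw [hb]
    simp only [norm_div, norm_mul, norm_pow, Complex.norm_real,
      Real.norm_of_nonneg (Real.sqrt_nonneg _)]
    -- This pulls `Y` out of the tail, leaving a planar series in `k` of bounded size.
    have hfac : √(m ! : ℝ) * √(k ! : ℝ) ≤ √((m + 1 + k)! : ℝ) := by
      rw [← Real.sqrt_mul (by positivity)]
      refine Real.sqrt_le_sqrt ?_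
      have h2 : m ! * k ! ≤ (m + 1 + k)! :=
        (Nat.le_of_dvd (Nat.factorial_pos _) (Nat.factorial_mul_factorial_dvd_factorial_add m k)).trans
          (Nat.factorial_le (by omega))
      exact_mod_cast h2
    calc ‖c (m + 1 + k)‖ * ‖z‖ ^ (m + 1 + k) / √((m + 1 + k)! : ℝ)
        ≤ ‖c (m + 1 + k)‖ * ‖z‖ ^ (m + 1 + k) / (√(m ! : ℝ) * √(k ! : ℝ)) := by gcongr
      _ = Y * ‖z‖ * (‖c (m + 1 + k)‖ * ‖z‖ ^ k / √(k ! : ℝ)) := by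
          rw [hY, pow_add, pow_add, pow_one]; field_simp
      _ ≤ Y * r * (4 * Real.exp (8 * r ^ 2) * (1 / 2) ^ k) := by gcongr
      _ = _ := by ring
  have hmain : ‖c m / ((√(m ! : ℝ) : ℝ) : ℂ) * z ^ m‖ = ‖c m‖ * Y := by
    rw [norm_mul, norm_div, norm_pow, Complex.norm_real, Real.norm_of_nonneg (Real.sqrt_nonneg _),
      hY]
    ring
  rw [hsplit, hmain]
  calc _ ≤ m * Y + 8 * r * Real.exp (8 * r ^ 2) * Y := (norm_add_le _ _).trans
        (add_le_add hblow hbhigh)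
    _ < (m + 8 * r * Real.exp (8 * r ^ 2) + 1) * Y := by linarith
    _ ≤ ‖c m‖ * Y := by gcongr

theorem exp_le_sq_sqrt_factorial_ratio {s : ℝ} (hs : 0 < s) {m n : ℕ} (hn : n < m) :
    Real.exp (-((m : ℝ) - n) * Real.log m - (2 * |Real.log s| + 1) * m) ≤
      (√((n ! : ℝ) / (m ! : ℝ)) * s ^ m) ^ 2 * Real.exp (-1) := by
  have hm1 : (1 : ℝ) ≤ m := by exact_mod_cast (show 1 ≤ m by omega)
  have hfac : (m ! : ℝ) ≤ n ! * (m : ℝ) ^ (m - n) := by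
    have h1 := Nat.factorial_mul_descFactorial (Nat.sub_le m n)
    rw [Nat.sub_sub_self hn.le] at h1
    rw [← h1]
    push_cast
    gcongr
    exact_mod_cast Nat.descFactorial_le_pow m (m - n)
  have hlog := Real.log_le_log (by positivity) hfac
  rw [Real.log_mul (by positivity) (by positivity), Real.log_pow, Nat.cast_sub hn.le] at hlog
  rw [← Real.le_log_iff_exp_le (by positivity), mul_pow, Real.sq_sqrt (by positivity),
    Real.log_mul (by positivity) (by positivity), Real.log_mul (by positivity) (by positivity),
    Real.log_div (by positivity) (by positivity), Real.log_pow, Real.log_pow, Real.log_exp]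
  have h2 := mul_le_mul_of_nonneg_left (neg_abs_le (Real.log s)) (zero_le_one.trans hm1)
  push_cast
  linarith

/-- The sum of `m - n` is `m(m+1)/2`; the surplus `½ m log m` is absorbed by the extra `m²`. -/
theorem exp_le_prod_exp (m : ℕ) (hm : 1 ≤ m) (C : ℝ) :
    Real.exp (-(1 / 2) * (m : ℝ) ^ 2 * Real.log m - (C + 1) * (m : ℝ) ^ 2) ≤
      ∏ n ∈ Finset.range m, Real.exp (-((m : ℝ) - n) * Real.log m - C * m) := by
  rw [← Real.exp_sum, Real.exp_le_exp, Finset.sum_sub_distrib, ← Finset.sum_mul,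
    Finset.sum_neg_distrib, Finset.sum_sub_distrib]
  have hm1 : (1 : ℝ) ≤ m := by exact_mod_cast hm
  have h2 : Real.log m ≤ m := (Real.log_le_sub_one_of_pos (by linarith)).trans (by linarith)
  simp only [Finset.sum_const, Finset.card_range, nsmul_eq_mul]
  have h3 : (∑ n ∈ Finset.range m, (n : ℝ)) = m * (m - 1) / 2 := by
    linarith [sum_range_cast_mul_two m]
  rw [h3]
  nlinarith [mul_le_mul_of_nonneg_left h2 (zero_le_one.trans hm1)]

theorem exists_le_gaussianSeqLaw_le_zeroCount {r : ℝ} (hr : 0 < r) : ∃ C : ℝ, ∀ m : ℕ, 1 ≤ m →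
    Real.exp (-(1 / 2) * (m : ℝ) ^ 2 * Real.log m - C * (m : ℝ) ^ 2) ≤
      gaussianSeqLaw.real {c | (m : ℕ∞) ≤ zeroCount (planarSeries c) r} := by
  set s : ℝ := min 1 (r / 2) with hs_def
  have hs : 0 < s := lt_min one_pos (by linarith)
  have hs1 : s ≤ 1 := min_le_left _ _
  set K : ℝ := 8 * r * Real.exp (8 * r ^ 2) with hK
  have hK0 : 0 ≤ K := by positivity
  set B : ℝ := 2 * |Real.log s| + 1 with hB
  -- The summands are the costs of the low coefficients (`B + 1`), of the large `m`-th one (`m + K +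
  -- 3 ≤ (K + 4) m`), and of the tail (`exp (-m²) ≤ 1/2`).
  refine ⟨B + 1 + (K + 4) ^ 2 + 1, fun m hm => ?_⟩
  have hm1 : (1 : ℝ) ≤ m := by exact_mod_cast hm
  set ρ : ℕ → ℝ := fun n => √((n ! : ℝ) / (m ! : ℝ)) * s ^ m with hρ
  set t : ℕ → Set ℂ := fun n => if n < m then Metric.closedBall 0 (ρ n)
    else if n = m then {z | m + K + 1 ≤ ‖z‖} else Metric.closedBall 0 (4 * 2 ^ (n - (m + 1)))
    with ht
  have htm : ∀ n, MeasurableSet (t n) := by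
    intro n
    simp only [ht]
    split_ifs
    · exact measurableSet_closedBall
    · exact measurableSet_le measurable_const measurable_norm
    · exact measurableSet_closedBall
  have hthigh : ∀ k, t (m + 1 + k) = Metric.closedBall 0 (4 * 2 ^ k) := by
    intro k
    simp only [ht]
    rw [if_neg (by omega), if_neg (by omega), Nat.add_sub_cancel_left]
  have hsub : Set.univ.pi t ⊆ {c | (m : ℕ∞) ≤ zeroCount (planarSeries c) r} := by
    intro c hc
    have hc' : ∀ n, c n ∈ t n := fun n => hc n trivial
    refine (zeroCount_planarSeries_eq hs hs1 (min_le_right _ _) (c := c) (m := m)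
      (fun n hn => ?_) ?_ fun k => ?_).ge
    · have := hc' n
      simp only [ht, if_pos hn] at this
      exact mem_closedBall_zero_iff.1 this
    · have := hc' m
      simpa [ht] using this
    · have := hc' (m + 1 + k)
      rw [hthigh] at this
      simpa using this
  have hprod : ENNReal.ofReal (Real.exp (-(1 / 2) * (m : ℝ) ^ 2 * Real.log m -
      (B + 1) * (m : ℝ) ^ 2)) ≤ ∏ n ∈ Finset.range m, stdComplexGaussian (t n) := by
    refine (ENNReal.ofReal_le_ofReal (exp_le_prod_exp m hm B)).trans ?_
    rw [ENNReal.ofReal_prod_of_nonneg fun n _ => (Real.exp_pos _).le]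
    refine Finset.prod_le_prod' fun n hn => ?_
    have hnm : n < m := Finset.mem_range.1 hn
    have hρ1 : ρ n ≤ 1 := by
      refine mul_le_one₀ ?_ (by positivity) (pow_le_one₀ hs.le hs1)
      rw [Real.sqrt_le_one, div_le_one (by positivity)]
      exact_mod_cast Nat.factorial_le hnm.le
    have hρ0 : 0 ≤ ρ n := by positivity
    simp only [ht, if_pos hnm]
    exact (ENNReal.ofReal_le_ofReal (exp_le_sq_sqrt_factorial_ratio hs hnm)).trans
      (le_stdComplexGaussian_closedBall_zero _ hρ0 hρ1)
  have hmid : ENNReal.ofReal (Real.exp (-((K + 4) ^ 2 * (m : ℝ) ^ 2))) ≤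
      stdComplexGaussian (t m) := by
    simp only [ht, lt_irrefl, if_false, if_true]
    refine (ENNReal.ofReal_le_ofReal ?_).trans
      (le_stdComplexGaussian_compl_ball (m + K + 1) (by positivity))
    rw [Real.exp_le_exp, neg_le_neg_iff, ← mul_pow]
    refine pow_le_pow_left₀ (by positivity) ?_ 2
    nlinarith
  have htail : ENNReal.ofReal (Real.exp (-(m : ℝ) ^ 2)) ≤
      gaussianSeqLaw {c | ∀ k, c (m + 1 + k) ∈ t (m + 1 + k)} := by
    refine (ENNReal.ofReal_le_ofReal ?_).trans
      ((half_le_gaussianSeqLaw_forall_norm_le (m + 1)).trans (measure_mono fun c hc k => ?_))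
    · rw [Real.exp_neg, one_div]
      gcongr
      have := Real.add_one_le_exp ((m : ℝ) ^ 2)
      nlinarith
    · rw [hthigh]
      simpa using hc k
  have hall := (prod_mul_gaussianSeqLaw_le htm (m + 1)).trans (measure_mono hsub)
  rw [Finset.prod_range_succ] at hall
  rw [measureReal_def, ← ENNReal.ofReal_le_iff_le_toReal (measure_ne_top _ _)]
  refine le_trans ?_ ((mul_le_mul' (mul_le_mul' hprod hmid) htail).trans hall)
  rw [← ENNReal.ofReal_mul (by positivity), ← ENNReal.ofReal_mul (by positivity), ← Real.exp_add,
    ← Real.exp_add]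
  refine ENNReal.ofReal_le_ofReal (Real.exp_le_exp.2 (le_of_eq ?_))
  ring

/-! ### Absorbing `O(m²)` and the asymptotic form -/

theorem sq_mul_le_of_log {C ε : ℝ} (hC : 0 ≤ C) (hε : 0 < ε) {m : ℕ} (hm : 1 ≤ m) :
    C * (m : ℝ) ^ 2 ≤ C * Real.exp (C / ε) ^ 2 + ε * (m : ℝ) ^ 2 * Real.log m := by
  have hm0 : (0 : ℝ) < m := by exact_mod_cast hm
  have hlog : 0 ≤ Real.log m := Real.log_natCast_nonneg m
  rcases le_total (C / ε) (Real.log m) with h | h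
  · rw [div_le_iff₀ hε] at h
    have h1 := mul_le_mul_of_nonneg_left h (sq_nonneg (m : ℝ))
    have h2 : 0 ≤ C * Real.exp (C / ε) ^ 2 := by positivity
    nlinarith
  · have h1 : (m : ℝ) ≤ Real.exp (C / ε) := (Real.log_le_iff_le_exp hm0).1 h
    have h2 : 0 ≤ ε * (m : ℝ) ^ 2 * Real.log m := by positivity
    have h3 : C * (m : ℝ) ^ 2 ≤ C * Real.exp (C / ε) ^ 2 := by gcongr
    linarith

/-- The relative error of `½ m² log m` as an approximation of `-log (p m)`. -/
noncomputable def relativeLogError (p : ℕ → ℝ) (m : ℕ) : ℝ :=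
  -Real.log (p m) / (1 / 2 * (m : ℝ) ^ 2 * Real.log m) - 1

theorem exp_relativeLogError {p : ℕ → ℝ} {m : ℕ} (hm : 2 ≤ m) (hp : 0 < p m) :
    p m = Real.exp (-(1 / 2) * (m : ℝ) ^ 2 * Real.log m * (1 + relativeLogError p m)) := by
  have hm0 : (0 : ℝ) < m := by exact_mod_cast (show 0 < m by omega)
  have hlog : 0 < Real.log m := Real.log_pos (by exact_mod_cast hm)
  have h : -(1 / 2) * (m : ℝ) ^ 2 * Real.log m * (1 + relativeLogError p m) = Real.log (p m) := by
    unfold relativeLogError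
    field_simp
    ring
  rw [h, Real.exp_log hp]

theorem tendsto_relativeLogError {p : ℕ → ℝ} {C D : ℝ}
    (hlow : ∀ m : ℕ, 1 ≤ m →
      Real.exp (-(1 / 2) * (m : ℝ) ^ 2 * Real.log m - C * (m : ℝ) ^ 2) ≤ p m)
    (hupp : ∀ m : ℕ, 1 ≤ m →
      p m ≤ 5 * Real.exp (-(1 / 2) * (m : ℝ) ^ 2 * Real.log m + D * (m : ℝ) ^ 2)) :
    Tendsto (relativeLogError p) atTop (𝓝 0) := by
  have hlogtop : Tendsto (fun m : ℕ => Real.log m) atTop atTop :=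
    Real.tendsto_log_atTop.comp tendsto_natCast_atTop_atTop
  refine tendsto_of_tendsto_of_tendsto_of_le_of_le'
    (hlogtop.const_div_atTop (-(2 * (D + Real.log 5)))) (hlogtop.const_div_atTop (2 * C)) ?_ ?_
  all_goals
    filter_upwards [eventually_ge_atTop 2] with m hm
    have hm1 : (1 : ℝ) ≤ m := by exact_mod_cast (show 1 ≤ m by omega)
    have hm0 : (0 : ℝ) < m := by linarith
    have hlog : 0 < Real.log m := Real.log_pos (by exact_mod_cast hm)
    have hl := hlow m (by omega)
    have hp : 0 < p m := (Real.exp_pos _).trans_le hl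
    unfold relativeLogError
  · have hu := Real.log_le_log hp (hupp m (by omega))
    rw [Real.log_mul (by norm_num) (Real.exp_pos _).ne', Real.log_exp] at hu
    have h5 : 0 ≤ Real.log 5 := Real.log_nonneg (by norm_num)
    -- The prefactor `5` joins the `m²` term, so the relative error is squeezed between multiples of
    -- `1 / log m`.
    have h6 : Real.log 5 ≤ Real.log 5 * (m : ℝ) ^ 2 :=
      le_mul_of_one_le_right h5 (one_le_pow₀ hm1)
    rw [le_sub_iff_add_le, le_div_iff₀ (by positivity)]
    have h7 : (-(2 * (D + Real.log 5)) / Real.log m + 1) * (1 / 2 * (m : ℝ) ^ 2 * Real.log m) =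
        -(D + Real.log 5) * (m : ℝ) ^ 2 + 1 / 2 * (m : ℝ) ^ 2 * Real.log m := by
      field_simp
    rw [h7]
    linarith
  · rw [← Real.le_log_iff_exp_le hp] at hl
    rw [sub_le_iff_le_add, div_le_iff₀ (by positivity)]
    have h7 : (2 * C / Real.log m + 1) * (1 / 2 * (m : ℝ) ^ 2 * Real.log m) =
        C * (m : ℝ) ^ 2 + 1 / 2 * (m : ℝ) ^ 2 * Real.log m := by
      field_simp
    rw [h7]
    linarith

theorem theorem8p1 (r : ℝ) (hr : 0 < r) :
    (∃ C : ℝ, ∀ (Ω : Type u) [MeasurableSpace Ω] (P : Measure Ω) [IsProbabilityMeasure P]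
        (a : ℕ → Ω → ℂ), IsIIDStdComplexGaussian P a → ∀ m : ℕ, 1 ≤ m →
        Real.exp (-(1 / 2) * (m : ℝ) ^ 2 * Real.log m - C * (m : ℝ) ^ 2)
          ≤ overcrowdingProb P a r m) ∧
    (∀ ε : ℝ, 0 < ε → ∃ C₂ : ℝ, ∀ (Ω : Type u) [MeasurableSpace Ω] (P : Measure Ω)
        [IsProbabilityMeasure P] (a : ℕ → Ω → ℂ), IsIIDStdComplexGaussian P a →
        ∀ m : ℕ, 1 ≤ m →
        overcrowdingProb P a r m
          ≤ C₂ * Real.exp (-(1 / 2 - ε) * (m : ℝ) ^ 2 * Real.log m)) ∧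
    (∃ δ : ℕ → ℝ, Tendsto δ atTop (𝓝 0) ∧
      ∀ (Ω : Type u) [MeasurableSpace Ω] (P : Measure Ω) [IsProbabilityMeasure P]
        (a : ℕ → Ω → ℂ), IsIIDStdComplexGaussian P a → ∀ m : ℕ, 2 ≤ m →
        overcrowdingProb P a r m
          = Real.exp (-(1 / 2) * (m : ℝ) ^ 2 * Real.log m * (1 + δ m))) := by
  obtain ⟨C, hlow⟩ := exists_le_gaussianSeqLaw_le_zeroCount hr
  obtain ⟨D, hD, hupp⟩ := exists_gaussianSeqLaw_le_zeroCount_le hr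
  refine ⟨⟨C, fun Ω _ P _ a ha m hm => ?_⟩, fun ε hε =>
    ⟨5 * Real.exp (D * Real.exp (D / ε) ^ 2), fun Ω _ P _ a ha m hm => ?_⟩,
    relativeLogError fun m =>
      gaussianSeqLaw.real {c | (m : ℕ∞) ≤ zeroCount (planarSeries c) r},
    tendsto_relativeLogError hlow hupp, fun Ω _ P _ a ha m hm => ?_⟩
  · rw [overcrowdingProb_eq_gaussianSeqLaw ha hr]
    exact hlow m hm
  · rw [overcrowdingProb_eq_gaussianSeqLaw ha hr, mul_assoc, ← Real.exp_add]
    refine (hupp m hm).trans ?_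
    refine mul_le_mul_of_nonneg_left (Real.exp_le_exp.2 ?_) (by norm_num)
    linarith [sq_mul_le_of_log hD hε hm]
  · rw [overcrowdingProb_eq_gaussianSeqLaw ha hr]
    have hp := (Real.exp_pos _).trans_le (hlow m (by omega))
    exact exp_relativeLogError (p := fun m =>
      gaussianSeqLaw.real {c | (m : ℕ∞) ≤ zeroCount (planarSeries c) r}) hm hp
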